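/- Let $n\ge 1$, $k\in\{1,\dots,n\}$, and let $d_1,\dots,d_n$ be non-negative integers with $d_1>0$. Let $\mu$ be the Fabre-like substitution on the alphabet $\{a_1,\dots,a_n\}$ given by $a_i\mapsto a_1^{d_i}a_{i+1}$ for $1\le i\le n-1$ and $a_n\mapsto a_1^{d_n}a_k$, and let $u=u_0u_1u_2\cdots$ be its right-infinite fixed point with $u_0=a_1$. The Dumont--Thomas numeration system associated with $\mu$ and the seed $a_1$ represents $0$ by the empty word and $m\ge 1$ by the word $|m_{\ell-1}|\cdots|m_0|$, where $(m_i,b_i)_{0\le i<\ell}$ (with $m_i$ a finite word and $b_i$ a letter) is the unique finite sequence such that $m_{\ell-1}b_{\ell-1}$ is a prefix of $\mu(a_1)$, $m_{i-1}b_{i-1}$ is a prefix of $\mu(b_i)$ for $1\le i\le \ell-1$, $m_{\ell-1}$ is non-empty, and $u_0\cdots u_{m-1}=\mu^{\ell-1}(m_{\ell-1})\cdots\mu^0(m_0)$. For a real $\beta>1$ let $d_\beta(1)=t_1t_2\cdots$ be the greedy (R\'enyi) expansion of $1$, that is, $t_i=\lfloor\beta r_{i-1}\rfloor$ with $r_0=1$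 and $r_i=\beta r_{i-1}-t_i$, and let the quasi-greedy expansion $d^*_\beta(1)$ be $(t_1\cdots t_{\ell-1}(t_\ell-1))^\omega$ if $d_\beta(1)=t_1\cdots t_\ell 0^\omega$ with $t_\ell\neq 0$, and $d_\beta(1)$ otherwise. A Bertrand numeration system represents every natural number by the greedy algorithm with respect to a weight sequence $(U_i)_{i\ge 0}$ which is either $U_i=i+1$ for all $i$ (trivial), or is given by $U_0=1$ and $U_i=e_1U_{i-1}+e_2U_{i-2}+\cdots+e_iU_0+1$ for $i\ge 1$, where $e_1e_2\cdots$ is $d^*_\beta(1)$ (canonical) or $d_\beta(1)$ (non-canonical) for some real $\beta>1$. Two numeration systems are equal if every natural number is represented by the same word in both. Define the infinite word $d_1d_2\cdots=d_1\cdots d_{k-1}(d_k\cdots d_n)^\omega$. Then the Dumont--Thomas numeration system associated with $\mu$ and the seed $a_1$ is equal to a Bertrand numeration system if and only if $d_id_{i+1}\cdots\preccurlyeq_{\mathrm{lex}}d_1d_2\cdots$ for every $i\ge 1$. -/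

import Mathlib

open Filter

/-! Words over `A` are lists, right-infinite words are functions `ℕ → A`. -/

/-- The extension to finite words, by concatenation, of a map from letters to words. -/
def applyWord {A : Type*} (f : A → List A) (w : List A) : List A := w.flatMap f

/-- A letter `a` is growing if `|f^ℓ(a)| → +∞`. -/
def IsGrowing {A : Type*} (f : A → List A) (a : A) : Prop :=
  Tendsto (fun ℓ : ℕ => ((applyWord f)^[ℓ] [a]).length) atTop atTop

/-- A substitution, given by the images of the letters: all images are non-empty and some letter
is growing. -/
structure Substitution (A : Type*) where
  image : A → List A
  image_ne_nil : ∀ a, image a ≠ []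
  exists_growing : ∃ a, IsGrowing image a

/-- The prefix `u_0 ⋯ u_{n-1}` of a right-infinite word. -/
def wordPrefix {A : Type*} (u : ℕ → A) (n : ℕ) : List A := (List.range n).map u

namespace Substitution

variable {A : Type*} (μ : Substitution A)

/-- The word `μ^ℓ(w)`. -/
def iter (ℓ : ℕ) (w : List A) : List A := (applyWord μ.image)^[ℓ] w

/-- `μ(u) = u` for a right-infinite word `u`: the image of every finite prefix of `u` is again
a prefix of `u`. -/
def IsFixedPoint (u : ℕ → A) : Prop :=
  ∀ n, applyWord μ.image (wordPrefix u n) =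
    wordPrefix u (applyWord μ.image (wordPrefix u n)).length

/-- A finite sequence `(m_{k-1}, a_{k-1}), …, (m_0, a_0)`, listed in this order, is `a`-admissible
if `m_{k-1} a_{k-1}` is a prefix of `μ(a)` and `m_{i-1} a_{i-1}` is a prefix of `μ(a_i)` for
`1 ≤ i ≤ k-1`. -/
def IsAdmissible (a : A) : List (List A × A) → Prop
  | [] => True
  | (m, b) :: p => (m ++ [b]) <+: μ.image a ∧ IsAdmissible b p

/-- The word `μ^{k-1}(m_{k-1}) μ^{k-2}(m_{k-2}) ⋯ μ^0(m_0)` of a sequence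
`(m_{k-1}, a_{k-1}), …, (m_0, a_0)`. -/
def spell : List (List A × A) → List A
  | [] => []
  | (m, _) :: p => μ.iter p.length m ++ spell p

/-- The sequence `(m_{k-1}, a_{k-1}), …, (m_0, a_0)` decomposes the prefix of length `n` of `u`:
it is non-empty and `u_0`-admissible, `m_{k-1}` is not the empty word, and
`u_0 ⋯ u_{n-1} = μ^{k-1}(m_{k-1}) ⋯ μ^0(m_0)`. -/
def IsDecomposition (u : ℕ → A) (n : ℕ) (p : List (List A × A)) : Prop :=
  μ.IsAdmissible (u 0) p ∧ (∃ x ∈ p.head?, x.1 ≠ []) ∧ wordPrefix u n = μ.spell p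

variable {μ}

theorem iter_append (ℓ : ℕ) (v w : List A) : μ.iter ℓ (v ++ w) = μ.iter ℓ v ++ μ.iter ℓ w := by
  induction ℓ generalizing v w with
  | zero => rfl
  | succ ℓ ih =>
    simp only [iter, Function.iterate_succ_apply] at ih ⊢
    rw [← ih]; simp [applyWord]

theorem iter_succ (ℓ : ℕ) (w : List A) : μ.iter (ℓ + 1) w = μ.iter ℓ (applyWord μ.image w) := rfl

theorem iter_succ' (ℓ : ℕ) (w : List A) :
    μ.iter (ℓ + 1) w = applyWord μ.image (μ.iter ℓ w) :=
  Function.iterate_succ_apply' _ _ _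

theorem iter_nil (ℓ : ℕ) : μ.iter ℓ [] = [] := by
  induction ℓ with
  | zero => rfl
  | succ ℓ ih => rw [iter_succ', ih]; rfl

theorem iter_succ_singleton (ℓ : ℕ) (a : A) : μ.iter (ℓ + 1) [a] = μ.iter ℓ (μ.image a) := by
  simp [iter_succ, applyWord]

/-- Splitting a position in `μ^ℓ(w)` according to the letters of `w`. -/
theorem exists_split (ℓ : ℕ) (w : List A) (n : ℕ) (h : n < (μ.iter ℓ w).length) :
    ∃ m b s, w = m ++ b :: s ∧ (μ.iter ℓ m).length ≤ n ∧
      n < (μ.iter ℓ m).length + (μ.iter ℓ [b]).length := by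
  induction w generalizing n with
  | nil => simp [iter_nil] at h
  | cons c w ih =>
    by_cases hc : n < (μ.iter ℓ [c]).length
    · exact ⟨[], c, w, rfl, by simp [iter_nil], by simpa [iter_nil] using hc⟩
    · have e : μ.iter ℓ (c :: w) = μ.iter ℓ [c] ++ μ.iter ℓ w := iter_append ℓ [c] w
      rw [e, List.length_append] at h
      obtain ⟨m, b, s, rfl, h1, h2⟩ := ih (n - (μ.iter ℓ [c]).length) (by omega)
      have e' : μ.iter ℓ (c :: m) = μ.iter ℓ [c] ++ μ.iter ℓ m := iter_append ℓ [c] m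
      refine ⟨c :: m, b, s, rfl, ?_, ?_⟩ <;> rw [e', List.length_append] <;> omega

theorem split_unique (ℓ n : ℕ) (m m' s s' : List A) (b b' : A)
    (h : m ++ b :: s = m' ++ b' :: s')
    (h1 : (μ.iter ℓ m).length ≤ n) (h2 : n < (μ.iter ℓ m).length + (μ.iter ℓ [b]).length)
    (h1' : (μ.iter ℓ m').length ≤ n) (h2' : n < (μ.iter ℓ m').length + (μ.iter ℓ [b']).length) :
    m = m' ∧ b = b' := by
  induction m generalizing m' n with
  | nil =>
    cases m' with
    | nil => simp at h; exact ⟨rfl, h.1⟩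
    | cons c m' =>
      exfalso
      simp at h
      have e' : μ.iter ℓ (c :: m') = μ.iter ℓ [c] ++ μ.iter ℓ m' := iter_append ℓ [c] m'
      rw [e', List.length_append, ← h.1] at h1'
      simp [iter_nil] at h2
      omega
  | cons c m ih =>
    have e : μ.iter ℓ (c :: m) = μ.iter ℓ [c] ++ μ.iter ℓ m := iter_append ℓ [c] m
    rw [e, List.length_append] at h1 h2
    cases m' with
    | nil =>
      exfalso
      simp at h
      simp [iter_nil, ← h.1] at h2'
      omega
    | cons c' m' =>
      have e' : μ.iter ℓ (c' :: m') = μ.iter ℓ [c'] ++ μ.iter ℓ m' := iter_append ℓ [c'] m'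
      rw [e', List.length_append] at h1' h2'
      simp at h
      obtain ⟨rfl, h⟩ := h
      obtain ⟨rfl, rfl⟩ := ih (n - (μ.iter ℓ [c]).length) m' h (by omega) (by omega) (by omega)
        (by omega)
      exact ⟨rfl, rfl⟩

theorem IsAdmissible.spell_length_lt {a : A} {p : List (List A × A)} (h : μ.IsAdmissible a p) :
    (μ.spell p).length < (μ.iter p.length [a]).length := by
  induction p generalizing a with
  | nil => simp [spell, iter]
  | cons x p ih =>
    obtain ⟨m, b⟩ := x
    obtain ⟨⟨s, hs⟩, hp⟩ := h
    have := ih hp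
    rw [List.length_cons, iter_succ_singleton, ← hs, iter_append, iter_append]
    simp only [spell, List.length_append]
    omega

theorem IsAdmissible.spell_prefix {a : A} {p : List (List A × A)} (h : μ.IsAdmissible a p) :
    μ.spell p <+: μ.iter p.length [a] := by
  induction p generalizing a with
  | nil => simp [spell]
  | cons x p ih =>
    obtain ⟨m, b⟩ := x
    obtain ⟨⟨s, hs⟩, hp⟩ := h
    obtain ⟨t, ht⟩ := ih hp
    rw [List.length_cons, iter_succ_singleton, ← hs, iter_append, iter_append, ← ht]
    exact ⟨t ++ μ.iter p.length s, by simp [spell]⟩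

theorem exists_admissible (k : ℕ) (a : A) (n : ℕ) (h : n < (μ.iter k [a]).length) :
    ∃ p, p.length = k ∧ μ.IsAdmissible a p ∧ (μ.spell p).length = n := by
  induction k generalizing a n with
  | zero => exact ⟨[], rfl, trivial, by simp [iter] at h; simp [spell, h]⟩
  | succ k ih =>
    rw [iter_succ_singleton] at h
    obtain ⟨m, b, s, e, h1, h2⟩ := exists_split k _ n h
    obtain ⟨p, hp, ha, hl⟩ := ih b (n - (μ.iter k m).length) (by omega)
    refine ⟨(m, b) :: p, by simp [hp], ⟨⟨s, by simp [e]⟩, ha⟩, ?_⟩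
    simp only [spell, List.length_append, hp, hl]
    omega

theorem admissible_unique (p q : List (List A × A)) (a : A) (hl : p.length = q.length)
    (hp : μ.IsAdmissible a p) (hq : μ.IsAdmissible a q)
    (h : (μ.spell p).length = (μ.spell q).length) : p = q := by
  induction p generalizing a q with
  | nil => exact (List.length_eq_zero_iff.1 hl.symm).symm
  | cons x p ih =>
    cases q with
    | nil => simp at hl
    | cons y q =>
      obtain ⟨m, b⟩ := x
      obtain ⟨m', b'⟩ := y
      obtain ⟨⟨s, hs⟩, hp⟩ := hp
      obtain ⟨⟨s', hs'⟩, hq⟩ := hq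
      simp only [List.length_cons, add_left_inj] at hl
      have l1 := hp.spell_length_lt
      have l2 := hq.spell_length_lt
      simp only [spell, List.length_append, ← hl] at h l2
      obtain ⟨rfl, rfl⟩ := split_unique (μ := μ) p.length
        ((μ.iter p.length m).length + (μ.spell p).length) m m' s s' b b'
        (by simpa using hs.trans hs'.symm) (by omega) (by omega) (by omega) (by omega)
      rw [ih q b hl hp hq (by omega)]

theorem wordPrefix_length (u : ℕ → A) (n : ℕ) : (wordPrefix u n).length = n := by
  simp [wordPrefix]

theorem wordPrefix_take (u : ℕ → A) {m n : ℕ} (h : m ≤ n) :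
    (wordPrefix u n).take m = wordPrefix u m := by
  simp [wordPrefix, ← List.map_take, List.take_range, h]

theorem IsFixedPoint.iter_eq {u : ℕ → A} (hu : μ.IsFixedPoint u) (k : ℕ) :
    μ.iter k [u 0] = wordPrefix u (μ.iter k [u 0]).length := by
  induction k with
  | zero => simp [iter, wordPrefix]
  | succ k ih =>
    rw [iter_succ', ih]
    exact hu _

theorem IsFixedPoint.image_head {u : ℕ → A} (hu : μ.IsFixedPoint u) :
    ∃ t, μ.image (u 0) = u 0 :: t := by
  have h := hu.iter_eq 1
  rw [iter_succ_singleton] at h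
  simp only [iter, Function.iterate_zero, id] at h
  obtain ⟨c, t, e⟩ := List.exists_cons_of_ne_nil (μ.image_ne_nil (u 0))
  rw [e] at h
  simp [wordPrefix, List.range_succ_eq_map] at h
  exact ⟨t, by rw [e, h.1]⟩

theorem IsFixedPoint.length_mono {u : ℕ → A} (hu : μ.IsFixedPoint u) :
    Monotone fun k => (μ.iter k [u 0]).length := by
  refine monotone_nat_of_le_succ fun k => ?_
  obtain ⟨t, e⟩ := hu.image_head
  have e' : μ.iter k (u 0 :: t) = μ.iter k [u 0] ++ μ.iter k t := iter_append k [u 0] t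
  rw [iter_succ_singleton, e, e', List.length_append]
  omega

/-- Existence and uniqueness of the decomposition, which the definition of the numeration system
needs. -/
theorem existsUnique_decomposition {u : ℕ → A} (hu : μ.IsFixedPoint u)
    (hg : IsGrowing μ.image (u 0)) {n : ℕ} (hn : n ≠ 0) : ∃! p, μ.IsDecomposition u n p := by
  obtain ⟨t, et⟩ := hu.image_head
  have key : ∀ p, μ.IsDecomposition u n p → ∃ j, p.length = j + 1 ∧
      (μ.iter j [u 0]).length ≤ n ∧ n < (μ.iter (j + 1) [u 0]).length := by
    rintro (_ | ⟨⟨m, b⟩, p⟩) ⟨ha, ⟨x, hx, hx1⟩, hs⟩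
    · simp at hx
    · simp at hx
      subst hx
      have hlen := ha.spell_length_lt
      rw [← hs, wordPrefix_length] at hlen
      refine ⟨p.length, rfl, ?_, hlen⟩
      have hs' := congrArg List.length hs
      obtain ⟨c, m', rfl⟩ := List.exists_cons_of_ne_nil hx1
      obtain ⟨⟨s, e⟩, -⟩ := ha
      rw [et] at e
      simp at e
      have e' : μ.iter p.length (c :: m') = μ.iter p.length [c] ++ μ.iter p.length m' :=
        iter_append _ [c] m'
      rw [wordPrefix_length, spell, List.length_append, e', List.length_append, e.1] at hs'
      omega
  have hex : ∃ k, n < (μ.iter k [u 0]).length := by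
    obtain ⟨k, hk⟩ := (tendsto_atTop.1 hg (n + 1)).exists
    exact ⟨k, hk⟩
  obtain ⟨j, hj1, hj2⟩ : ∃ j, (μ.iter j [u 0]).length ≤ n ∧ n < (μ.iter (j + 1) [u 0]).length := by
    classical
    have h0 := Nat.find_spec hex
    rcases Nat.eq_zero_or_eq_succ_pred (Nat.find hex) with h | h
    · rw [h] at h0; simp [iter] at h0; omega
    · exact ⟨(Nat.find hex).pred, not_lt.1 (Nat.find_min hex (by omega)), by rw [h] at h0; exact h0⟩
  obtain ⟨p, hp, ha, hl⟩ := exists_admissible (j + 1) (u 0) n hj2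
  refine ⟨p, ⟨ha, ?_, ?_⟩, ?_⟩
  · obtain _ | ⟨⟨m, b⟩, p⟩ := p
    · simp at hp
    · refine ⟨(m, b), rfl, ?_⟩
      rintro rfl
      obtain ⟨⟨s, e⟩, hp'⟩ := ha
      rw [et] at e
      simp at e
      have := hp'.spell_length_lt
      simp only [List.length_cons, add_left_inj] at hp
      simp only [spell, iter_nil, List.nil_append] at hl
      rw [hl, hp, e.1] at this
      omega
  · have h1 := List.prefix_iff_eq_take.1 ha.spell_prefix
    rw [hl, hp, hu.iter_eq, wordPrefix_take _ hj2.le] at h1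
    exact h1.symm
  · intro q hq
    obtain ⟨i, hi, hi1, hi2⟩ := key q hq
    have hij : i = j := by
      rcases lt_trichotomy i j with h | h | h
      · have := hu.length_mono (show i + 1 ≤ j from h)
        simp only at this; omega
      · exact h
      · have := hu.length_mono (show j + 1 ≤ i from h)
        simp only at this; omega
    refine admissible_unique q p (u 0) (by omega) hq.1 ha ?_
    rw [hl, ← hq.2.2, wordPrefix_length]

/-- The representation map of the Dumont–Thomas numeration system over `ℕ` associated with `μ` and
a right-infinite fixed point `u` with growing seed `u_0`: `0` is represented by the empty word and
`n ≥ 1` by `|m_{k-1}| ⋯ |m_0|` for the unique decomposition of `u_0 ⋯ u_{n-1}`. -/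
noncomputable def dumontThomasRep (μ : Substitution A) (u : ℕ → A) (hu : μ.IsFixedPoint u)
    (hg : IsGrowing μ.image (u 0)) (n : ℕ) : List ℕ :=
  if hn : n = 0 then []
  else (existsUnique_decomposition hu hg hn).choose.map fun x => x.1.length

end Substitution

/-- The images of the letters under a Fabre-like substitution on the `n` letters `0, …, n - 1`
(the letter `i` stands for `a_{i+1}`): the letter `i` is mapped to `0^{d i}` followed by `i + 1`,
or followed by `k` if `i` is the last letter. -/
def fabreImage {n : ℕ} [NeZero n] (k : Fin n) (d : Fin n → ℕ) (i : Fin n) : List (Fin n) :=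
  List.replicate (d i) 0 ++ [if h : (i : ℕ) + 1 < n then ⟨i + 1, h⟩ else k]

theorem fabreImage_strictMono {n : ℕ} [NeZero n] (k : Fin n) (d : Fin n → ℕ) (hd : 0 < d 0) :
    StrictMono fun ℓ : ℕ => ((applyWord (fabreImage k d))^[ℓ] [0]).length := by
  have hlen : ∀ w : List (Fin n), w.length ≤ (applyWord (fabreImage k d) w).length := by
    intro w
    induction w with
    | nil => simp
    | cons c w ih =>
      simp [applyWord, fabreImage] at ih ⊢
      omega
  have hhead : ∀ ℓ, ∃ w, (applyWord (fabreImage k d))^[ℓ] [0] = 0 :: w := by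
    intro ℓ
    induction ℓ with
    | zero => exact ⟨[], rfl⟩
    | succ ℓ ih =>
      obtain ⟨w, hw⟩ := ih
      rw [Function.iterate_succ_apply', hw]
      obtain ⟨e, he⟩ := Nat.exists_eq_succ_of_ne_zero hd.ne'
      simp [applyWord, fabreImage, he, List.replicate_succ]
  refine strictMono_nat_of_lt_succ fun ℓ => ?_
  obtain ⟨w, hw⟩ := hhead ℓ
  rw [Function.iterate_succ_apply', hw]
  have := hlen w
  simp [applyWord, fabreImage] at this ⊢
  omega

theorem fabreImage_isGrowing {n : ℕ} [NeZero n] (k : Fin n) (d : Fin n → ℕ) (hd : 0 < d 0) :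
    IsGrowing (fabreImage k d) 0 :=
  (fabreImage_strictMono k d hd).tendsto_atTop

/-- The Fabre-like substitution `a_1 ↦ a_1^{d_1} a_2, …, a_{n-1} ↦ a_1^{d_{n-1}} a_n,
a_n ↦ a_1^{d_n} a_k`, with `d_1 > 0`, on the letters `0, …, n - 1`. -/
def fabreLike {n : ℕ} [NeZero n] (k : Fin n) (d : Fin n → ℕ) (hd : 0 < d 0) :
    Substitution (Fin n) where
  image := fabreImage k d
  image_ne_nil := by simp [fabreImage]
  exists_growing := ⟨0, fabreImage_isGrowing k d hd⟩

/-- The right-infinite fixed point of a Fabre-like substitution with seed `a_1`, as the limit of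
the words `μ^ℓ(a_1)`. -/
def fabreFixedPoint {n : ℕ} [NeZero n] (k : Fin n) (d : Fin n → ℕ) (hd : 0 < d 0) (i : ℕ) :
    Fin n :=
  ((fabreLike k d hd).iter i [0]).getD i 0

theorem fabreFixedPoint_zero {n : ℕ} [NeZero n] (k : Fin n) (d : Fin n → ℕ) (hd : 0 < d 0) :
    fabreFixedPoint k d hd 0 = 0 := rfl

theorem fabreFixedPoint_isFixedPoint {n : ℕ} [NeZero n] (k : Fin n) (d : Fin n → ℕ)
    (hd : 0 < d 0) : (fabreLike k d hd).IsFixedPoint (fabreFixedPoint k d hd) := by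
  set μ := fabreLike k d hd with hμ
  set u := fabreFixedPoint k d hd with hu
  have himg : ∃ t, μ.image 0 = 0 :: t := by
    obtain ⟨e, he⟩ := Nat.exists_eq_succ_of_ne_zero hd.ne'
    simp [hμ, fabreLike, fabreImage, he, List.replicate_succ]
  obtain ⟨t, ht⟩ := himg
  have hpre : ∀ j l, j ≤ l → μ.iter j [0] <+: μ.iter l [0] := by
    intro j l hjl
    induction l, hjl using Nat.le_induction with
    | base => exact List.prefix_refl _
    | succ l _ ih =>
      refine ih.trans ⟨μ.iter l t, ?_⟩
      rw [Substitution.iter_succ_singleton, ht, ← Substitution.iter_append]; rfl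
  have hlen : ∀ j, j < (μ.iter j [0]).length := by
    have hs : StrictMono fun j => (μ.iter j [0]).length := fabreImage_strictMono k d hd
    intro j
    induction j with
    | zero => simp [Substitution.iter]
    | succ j ih => exact lt_of_le_of_lt ih (hs (Nat.lt_succ_self j))
  have hiter : ∀ j, μ.iter j [0] = wordPrefix u (μ.iter j [0]).length := by
    intro j
    refine List.ext_getElem (by simp [wordPrefix]) fun i h1 h2 => ?_
    have h3 : u i = (μ.iter i [0])[i]'(hlen i) := by
      simp [hu, fabreFixedPoint, ← hμ, hlen i]
    simp only [wordPrefix, List.getElem_map, List.getElem_range, h3]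
    rcases le_total i j with h | h
    · exact ((hpre i j h).getElem (hlen i)).symm
    · exact (hpre j i h).getElem h1
  intro n
  have h1 : wordPrefix u n <+: μ.iter n [0] := by
    rw [hiter n, ← Substitution.wordPrefix_take u (hlen n).le]
    exact List.take_prefix _ _
  obtain ⟨s, hs⟩ := h1
  have h2 : applyWord μ.image (wordPrefix u n) <+: μ.iter (n + 1) [0] := by
    rw [Substitution.iter_succ', ← hs]
    exact ⟨applyWord μ.image s, by simp [applyWord]⟩
  have h3 := List.prefix_iff_eq_take.1 h2
  rw [hiter (n + 1), Substitution.wordPrefix_take u h2.length_le] at h3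
  exact h3

/-- The right-infinite word `d_1 ⋯ d_{k-1} (d_k ⋯ d_n)^ω`, indexed from `0`; since `k : Fin n` is
also counted from `0`, the pre-period has length `k` and the period has length `n - k`. -/
def parryWord {n : ℕ} (k : Fin n) (d : Fin n → ℕ) (i : ℕ) : ℕ :=
  if h : i < k then d ⟨i, h.trans k.isLt⟩
  else d ⟨k + (i - k) % (n - k), by
    have := Nat.mod_lt (i - k) (Nat.sub_pos_of_lt k.isLt); omega⟩

/-! ### Bertrand numeration systems -/

/-- The orbit of `1` under the transformation `x ↦ β x - ⌊β x⌋`. -/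
noncomputable def betaOrbit (β : ℝ) : ℕ → ℝ
  | 0 => 1
  | i + 1 => Int.fract (β * betaOrbit β i)

/-- The Rényi expansion `d_β(1)` (greedy), digits indexed from `0`. -/
noncomputable def betaExpansion (β : ℝ) (i : ℕ) : ℕ := ⌊β * betaOrbit β i⌋₊

open Classical in
/-- The quasi-greedy expansion `d_β^*(1)`: it is `(d_1 ⋯ d_{ℓ-1} (d_ℓ - 1))^ω` if
`d_β(1) = d_1 ⋯ d_ℓ 0^ω` with `d_ℓ ≠ 0`, and `d_β(1)` otherwise. -/
noncomputable def quasiGreedyExpansion (β : ℝ) (i : ℕ) : ℕ :=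
  if h : ∃ ℓ, ∀ j, ℓ ≤ j → betaExpansion β j = 0 then
    if i % Nat.find h = Nat.find h - 1 then betaExpansion β (i % Nat.find h) - 1
    else betaExpansion β (i % Nat.find h)
  else betaExpansion β i

/-- The sequence `U_0 = 1`, `U_i = d_1 U_{i-1} + d_2 U_{i-2} + ⋯ + d_i U_0 + 1` for `i ≥ 1`; the
digit `d_{j+1}` is written `d j`. -/
def weightsOf (d : ℕ → ℕ) : ℕ → ℕ
  | 0 => 1
  | i + 1 => (∑ j : Fin (i + 1), d j * weightsOf d (i - j)) + 1
decreasing_by omega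

/-- The weights of the Bertrand numeration systems: trivial, canonical and non-canonical. -/
def IsBertrandWeights (U : ℕ → ℕ) : Prop :=
  (∀ i, U i = i + 1) ∨
  (∃ β : ℝ, 1 < β ∧ U = weightsOf (quasiGreedyExpansion β)) ∨
  (∃ β : ℝ, 1 < β ∧ U = weightsOf (betaExpansion β))

/-- The `ℓ` digits that the greedy algorithm produces for `m` on the weights
`U_{ℓ-1}, …, U_0`, the most significant digit first. -/
def greedyDigits (U : ℕ → ℕ) : ℕ → ℕ → List ℕ
  | 0, _ => []
  | ℓ + 1, m => m / U ℓ :: greedyDigits U ℓ (m % U ℓ)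

/-- The greedy representation of `m` for an unbounded increasing sequence of weights `U` with
`U_0 = 1`: its length is the least `ℓ` such that `m < U_ℓ`. -/
noncomputable def greedyRep (U : ℕ → ℕ) (m : ℕ) : List ℕ :=
  greedyDigits U (sInf {ℓ | m < U ℓ}) m

/-- The representation map `rep` is that of a Bertrand numeration system. -/
def IsBertrandRep (rep : ℕ → List ℕ) : Prop :=
  ∃ U : ℕ → ℕ, IsBertrandWeights U ∧ rep = greedyRep U

/-!
Write `t = t_0 t_1 ⋯` for the word `d_1 ⋯ d_{k-1} (d_k ⋯ d_n)^ω`. The lengths `|μ^ℓ(a_1)|` are the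
weights
`U = weightsOf t`, and the Dumont–Thomas representations of length at most `ℓ` are those of the
numbers below `U_ℓ`.

If the system is a Bertrand system with weights `weightsOf e`, then comparing the lengths of the
representations gives `weightsOf t = weightsOf e`, hence `t = e` (`weightsOf_injective`). Here `e`
is `1 0^ω`, `d_β(1)` or `d_β^*(1)`, and each of these words dominates its shifts: the digits of the
two expansions are monotone functions (`⌊β x⌋` and `⌈β x⌉ - 1`) of remainders, the largest of which
is the first (`shift_le_of_monotone_digits`).

Conversely, suppose that `t` dominates its shifts. Then `|μ^ℓ(b)| ≤ U_ℓ` for every letter `b`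
(`tailWeight_add_le`), so that the part of a decomposition after any position is smaller than the
weight of that position: the Dumont–Thomas digits are the greedy ones
(`map_length_eq_greedyDigits`). It remains to see that the weights are Bertrand weights
(`exists_eq_expansion`). If `t ≠ 1 0^ω`, then `∑ t_i β^{-(i+1)} = 1` for some `β > 1`, and by
domination all remainders `r_i = ∑ t_{i+j} β^{-(j+1)}` are at most `1` (`remainder_le_one`). If
`r_i < 1` for all `i ≥ 1`, the digits are those of `d_β(1)`. Otherwise let `p ≥ 1` be least with
`r_p = 1`: the greedy expansion is then `t_0 ⋯ t_{p-2} (t_{p-1} + 1) 0^ω`, and domination forces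
`t` to have period `p`, so that `t = d_β^*(1)`.
-/

/-! ### Weights of a word -/

/-- The lexicographic order, read at the first position where the words may differ. With
`a = t_i t_{i+1} ⋯` and `b = t`, the right-hand side says that the shift of `t` by `i` does not
exceed `t`; the lemmas below use it in this form. -/
theorem toLex_le_toLex_iff_first_diff (a b : ℕ → ℕ) :
    toLex a ≤ toLex b ↔ ∀ q, (∀ j < q, a j = b j) → a q ≤ b q := by
  constructor
  · intro h q hq
    by_contra! hlt
    exact absurd h (not_le.2 ⟨q, fun j hj => (hq j hj).symm, hlt⟩)
  · intro h
    by_contra! hlt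
    obtain ⟨q, hq, hlt⟩ := hlt
    exact absurd (h q fun j hj => (hq j hj).symm) (not_le.2 hlt)

/-- For a word `t`, the quantity `t_i U_{ℓ-1} + t_{i+1} U_{ℓ-2} + ⋯ + t_{i+ℓ-1} U_0 + 1`, where
`U` is the sequence of weights of `t`: it is the length of the `ℓ`-th image of the letter reached
after reading the maximal digits `t_0, …, t_{i-1}`. -/
def tailWeight (t : ℕ → ℕ) : ℕ → ℕ → ℕ
  | 0, _ => 1
  | ℓ + 1, i => t i * tailWeight t ℓ 0 + tailWeight t ℓ (i + 1)

theorem tailWeight_eq_sum (t : ℕ → ℕ) (ℓ i : ℕ) :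
    tailWeight t ℓ i = ∑ j ∈ Finset.range ℓ, t (i + j) * tailWeight t (ℓ - 1 - j) 0 + 1 := by
  induction ℓ generalizing i with
  | zero => simp [tailWeight]
  | succ ℓ ih =>
    have hj : ∀ j, t (i + 1 + j) * tailWeight t (ℓ - 1 - j) 0 =
        t (i + (j + 1)) * tailWeight t (ℓ + 1 - 1 - (j + 1)) 0 := fun j => by
      rw [show i + 1 + j = i + (j + 1) by omega, show ℓ + 1 - 1 - (j + 1) = ℓ - 1 - j by omega]
    rw [tailWeight, ih (i + 1), Finset.sum_range_succ', Finset.sum_congr rfl fun j _ => hj j,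
      add_zero, Nat.add_sub_cancel, Nat.sub_zero]
    ring

theorem weightsOf_succ (t : ℕ → ℕ) (i : ℕ) : weightsOf t (i + 1) =
    ∑ j ∈ Finset.range (i + 1), t j * weightsOf t (i - j) + 1 := by
  rw [weightsOf, Fin.sum_univ_eq_sum_range fun j => t j * weightsOf t (i - j)]

theorem weightsOf_zero (t : ℕ → ℕ) : weightsOf t 0 = 1 := by rw [weightsOf]

theorem tailWeight_zero_right (t : ℕ → ℕ) (ℓ : ℕ) : tailWeight t ℓ 0 = weightsOf t ℓ := by
  induction ℓ using Nat.strong_induction_on with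
  | _ ℓ ih =>
    cases ℓ with
    | zero => rw [weightsOf_zero, tailWeight]
    | succ ℓ =>
      rw [tailWeight_eq_sum, weightsOf_succ]
      congr 1
      refine Finset.sum_congr rfl fun j hj => ?_
      rw [Nat.add_sub_cancel, zero_add, ih _ (by omega)]

/-- If no shift of `t` exceeds `t`, then no tail weight exceeds the weight of the same level. The
statement is generalized to a shift that is known to agree with `t` on the first `q` digits. -/
theorem tailWeight_add_le (t : ℕ → ℕ)
    (h : ∀ i q, (∀ j < q, t (i + j) = t j) → t (i + q) ≤ t q) (ℓ i q : ℕ)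
    (hq : ∀ j < q, t (i + j) = t j) : tailWeight t ℓ (i + q) ≤ tailWeight t ℓ q := by
  induction ℓ generalizing i q with
  | zero => simp [tailWeight]
  | succ ℓ ih =>
    simp only [tailWeight]
    rcases (h i q hq).eq_or_lt with e | e
    · have := ih i (q + 1) fun j hj => by
        rcases Nat.lt_succ_iff_lt_or_eq.1 hj with hj | rfl
        exacts [hq j hj, e]
      rw [e]
      exact Nat.add_le_add_left this _
    · have h1 := ih (i + q + 1) 0 (by simp)
      calc t (i + q) * tailWeight t ℓ 0 + tailWeight t ℓ (i + q + 1)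
          ≤ (t (i + q) + 1) * tailWeight t ℓ 0 := by rw [add_one_mul]; exact Nat.add_le_add_left h1 _
        _ ≤ t q * tailWeight t ℓ 0 := Nat.mul_le_mul_right _ e
        _ ≤ _ := Nat.le_add_right _ _

theorem weightsOf_injective : Function.Injective weightsOf := by
  intro t s h
  funext i
  induction i using Nat.strong_induction_on with
  | _ i ih =>
    have h1 := congrFun h (i + 1)
    rw [weightsOf_succ, weightsOf_succ, h, Finset.sum_range_succ, Finset.sum_range_succ,
      Finset.sum_congr rfl fun j hj => by rw [ih j (Finset.mem_range.1 hj)]] at h1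
    simpa [weightsOf_zero] using h1

theorem weightsOf_strictMono (t : ℕ → ℕ) (h0 : 0 < t 0) : StrictMono (weightsOf t) := by
  refine strictMono_nat_of_lt_succ fun i => ?_
  rw [weightsOf_succ, Finset.sum_range_succ', Nat.sub_zero]
  have := Nat.le_mul_of_pos_left (weightsOf t i) h0
  omega

theorem weightsOf_single : weightsOf (Pi.single 0 1) = fun i => i + 1 := by
  funext i
  induction i with
  | zero => rw [weightsOf_zero]
  | succ i ih => rw [weightsOf_succ, Finset.sum_range_succ']; simp [ih]

/-! ### The numeration system of a Fabre-like substitution -/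

/-- The letter reached from `a_1` by reading `i` maximal digits: the letter at position `i` of
`a_1 ⋯ a_{k-1} (a_k ⋯ a_n)^ω`. -/
def fabreState {n : ℕ} (k : Fin n) (i : ℕ) : Fin n :=
  if h : i < k then ⟨i, h.trans k.isLt⟩
  else ⟨k + (i - k) % (n - k), by
    have := Nat.mod_lt (i - k) (Nat.sub_pos_of_lt k.isLt); omega⟩

theorem parryWord_eq {n : ℕ} (k : Fin n) (d : Fin n → ℕ) (i : ℕ) :
    parryWord k d i = d (fabreState k i) := by
  unfold parryWord fabreState
  split <;> rfl

theorem add_one_mod_eq_ite {b : ℕ} (hb : 0 < b) (i : ℕ) :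
    (i + 1) % b = if i % b = b - 1 then 0 else i % b + 1 := by
  have hi := Nat.mod_lt i hb
  rw [← Nat.mod_add_mod]
  split_ifs with h
  · rw [h, Nat.sub_add_cancel hb, Nat.mod_self]
  · exact Nat.mod_eq_of_lt (by omega)

theorem coe_fabreState {n : ℕ} (k : Fin n) (i : ℕ) :
    (fabreState k i : ℕ) = if i < k then i else k + (i - k) % (n - k) := by
  unfold fabreState
  split <;> rfl

theorem fabreState_zero {n : ℕ} [NeZero n] (k : Fin n) : fabreState k 0 = 0 := by
  ext
  rw [coe_fabreState, Fin.val_zero, Nat.zero_sub, Nat.zero_mod]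
  split_ifs <;> omega

theorem fabreState_succ {n : ℕ} (k : Fin n) (i : ℕ) : fabreState k (i + 1) =
    if h : (fabreState k i : ℕ) + 1 < n then ⟨fabreState k i + 1, h⟩ else k := by
  have hk := k.isLt
  have hval : (fabreState k (i + 1) : ℕ) =
      if (fabreState k i : ℕ) + 1 < n then (fabreState k i : ℕ) + 1 else k := by
    rw [coe_fabreState, coe_fabreState]
    rcases lt_or_ge i k with h | h
    · simp only [if_pos h]
      rw [if_pos (show i + 1 < n by omega)]
      split_ifs with h'
      · rfl
      · rw [show i + 1 - k = 0 by omega, Nat.zero_mod]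
        omega
    · simp only [if_neg (not_lt.2 h), if_neg (show ¬ i + 1 < (k : ℕ) by omega)]
      rw [show i + 1 - (k : ℕ) = i - k + 1 by omega,
        add_one_mod_eq_ite (show 0 < n - k by omega)]
      have := Nat.mod_lt (i - k) (show 0 < n - k by omega)
      split_ifs <;> omega
  ext
  rw [hval]
  split_ifs <;> rfl

section

variable {n : ℕ} [NeZero n] (k : Fin n) (d : Fin n → ℕ) (hd : 0 < d 0)

theorem length_iter_replicate (μ : Substitution (Fin n)) (ℓ w : ℕ) :
    (μ.iter ℓ (List.replicate w 0)).length = w * (μ.iter ℓ [0]).length := by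
  induction w with
  | zero => simp [Substitution.iter_nil]
  | succ w ih => rw [List.replicate_succ', Substitution.iter_append, List.length_append, ih]; ring

theorem length_iter_fabreState (ℓ i : ℕ) :
    ((fabreLike k d hd).iter ℓ [fabreState k i]).length = tailWeight (parryWord k d) ℓ i := by
  induction ℓ generalizing i with
  | zero => simp [Substitution.iter, tailWeight]
  | succ ℓ ih =>
    have himg : (fabreLike k d hd).image (fabreState k i) =
        List.replicate (parryWord k d i) 0 ++ [fabreState k (i + 1)] := by
      rw [fabreState_succ, parryWord_eq]; rfl
    have h0 := ih 0
    rw [fabreState_zero] at h0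
    rw [Substitution.iter_succ_singleton, himg, Substitution.iter_append, List.length_append,
      length_iter_replicate, ih, h0, tailWeight]

theorem length_iter_zero (ℓ : ℕ) :
    ((fabreLike k d hd).iter ℓ [0]).length = weightsOf (parryWord k d) ℓ := by
  rw [← tailWeight_zero_right, ← length_iter_fabreState k d hd, fabreState_zero]

/-- In a sequence admissible from a reachable letter, the first word is a power of `a_1`, so that it
is determined by its length, and the remaining sequence starts from a reachable letter again. -/
theorem fabreLike_admissible_cons {i : ℕ} {m : List (Fin n)} {b : Fin n}
    {p : List (List (Fin n) × Fin n)}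
    (h : (fabreLike k d hd).IsAdmissible (fabreState k i) ((m, b) :: p)) :
    m = List.replicate m.length 0 ∧
      ∃ i', b = fabreState k i' ∧ (fabreLike k d hd).IsAdmissible (fabreState k i') p := by
  obtain ⟨h1, h2⟩ := h
  have himg : (fabreLike k d hd).image (fabreState k i) =
      List.replicate (d (fabreState k i)) 0 ++ [fabreState k (i + 1)] := by
    rw [fabreState_succ]; rfl
  rw [himg, List.prefix_concat_iff] at h1
  rcases h1 with h1 | h1
  · obtain ⟨e1, e2⟩ := List.append_inj' h1 rfl
    simp only [List.cons.injEq, and_true] at e2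
    subst e2
    exact ⟨by rw [e1]; simp, _, rfl, h2⟩
  · have hr : ∀ x ∈ m ++ [b], x = 0 := fun x hx => List.eq_of_mem_replicate (h1.subset hx)
    have hb : b = 0 := hr b (by simp)
    refine ⟨List.eq_replicate_iff.2 ⟨rfl, fun x hx => hr x (by simp [hx])⟩, 0, ?_, ?_⟩
    · rw [fabreState_zero, hb]
    · rwa [fabreState_zero, ← hb]

/-- When no tail weight exceeds the weight of the same level, each remainder of an admissible
decomposition is smaller than the current weight, so the digits are those of the greedy
algorithm. -/
theorem map_length_eq_greedyDigits
    (hle : ∀ ℓ i, tailWeight (parryWord k d) ℓ i ≤ weightsOf (parryWord k d) ℓ)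
    (p : List (List (Fin n) × Fin n)) (i : ℕ)
    (hp : (fabreLike k d hd).IsAdmissible (fabreState k i) p) :
    p.map (fun x => x.1.length) = greedyDigits (weightsOf (parryWord k d)) p.length
      ((fabreLike k d hd).spell p).length := by
  induction p generalizing i with
  | nil => rfl
  | cons x p ih =>
    obtain ⟨m, b⟩ := x
    obtain ⟨hm, i', rfl, hp'⟩ := fabreLike_admissible_cons k d hd hp
    have hlt := hp'.spell_length_lt
    rw [length_iter_fabreState] at hlt
    replace hlt := hlt.trans_le (hle _ _)
    have hs : ((fabreLike k d hd).spell ((m, fabreState k i') :: p)).length =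
        ((fabreLike k d hd).spell p).length +
          weightsOf (parryWord k d) p.length * m.length := by
      rw [Substitution.spell, List.length_append, hm, length_iter_replicate, length_iter_zero,
        ← hm, add_comm, mul_comm]
    rw [List.length_cons, greedyDigits, hs, Nat.add_mul_div_left _ _ (by omega),
      Nat.add_mul_mod_self_left, Nat.div_eq_of_lt hlt, Nat.mod_eq_of_lt hlt, List.map_cons,
      ih i' hp', zero_add]

/-- The Dumont–Thomas representation of `m` is the word of lengths of an admissible sequence that
spells `m` letters, and it has length at most `ℓ` exactly when `m` is below the `ℓ`-th weight. -/
theorem exists_dumontThomasRep_eq (m : ℕ) :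
    ∃ p, (fabreLike k d hd).IsAdmissible 0 p ∧ ((fabreLike k d hd).spell p).length = m ∧
      (fabreLike k d hd).dumontThomasRep (fabreFixedPoint k d hd)
        (fabreFixedPoint_isFixedPoint k d hd) (fabreImage_isGrowing k d hd) m =
          p.map (fun x => x.1.length) ∧
      ∀ ℓ, p.length ≤ ℓ ↔ m < weightsOf (parryWord k d) ℓ := by
  have hmono : StrictMono (weightsOf (parryWord k d)) :=
    weightsOf_strictMono _ (by rwa [parryWord_eq, fabreState_zero])
  unfold Substitution.dumontThomasRep
  by_cases hm : m = 0
  · refine ⟨[], trivial, hm.symm, by simp [hm], fun ℓ => ?_⟩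
    have := hmono.monotone (Nat.zero_le ℓ)
    rw [weightsOf_zero] at this
    simp; omega
  · rw [dif_neg hm]
    set h := Substitution.existsUnique_decomposition (fabreFixedPoint_isFixedPoint k d hd)
      (fabreImage_isGrowing k d hd) hm
    obtain ⟨⟨ha, ⟨x, hx, hx1⟩, hs⟩, -⟩ := h.choose_spec
    rw [fabreFixedPoint_zero] at ha
    generalize h.choose = p at *
    have hl : ((fabreLike k d hd).spell p).length = m := by
      rw [← hs, Substitution.wordPrefix_length]
    refine ⟨p, ha, hl, rfl, fun ℓ => ?_⟩
    have hlt := ha.spell_length_lt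
    rw [hl, length_iter_zero] at hlt
    refine ⟨fun hp => hlt.trans_le (hmono.monotone hp), fun hp => ?_⟩
    obtain _ | ⟨⟨w, b⟩, p⟩ := p
    · simp
    · simp only [List.head?_cons, Option.mem_some_iff] at hx
      subst hx
      rw [← fabreState_zero k] at ha
      obtain ⟨hw, -⟩ := fabreLike_admissible_cons k d hd ha
      rw [Substitution.spell, List.length_append, hw, length_iter_replicate,
        length_iter_zero] at hl
      have := Nat.le_mul_of_pos_left (weightsOf (parryWord k d) p.length)
        (List.length_pos_iff.2 hx1)
      rw [List.length_cons, Nat.succ_le_iff, ← hmono.lt_iff_lt]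
      simp only at this hl ⊢
      omega

end

theorem length_greedyDigits (U : ℕ → ℕ) (ℓ m : ℕ) : (greedyDigits U ℓ m).length = ℓ := by
  induction ℓ generalizing m with
  | zero => rfl
  | succ ℓ ih => simp [greedyDigits, ih]

theorem sInf_lt_weight_le_iff {U : ℕ → ℕ} (hU : StrictMono U) (m ℓ : ℕ) :
    sInf {ℓ | m < U ℓ} ≤ ℓ ↔ m < U ℓ := by
  have hne : {ℓ | m < U ℓ}.Nonempty := ⟨m + 1, hU.le_apply (x := m + 1)⟩
  exact ⟨fun h => (Nat.sInf_mem hne).trans_le (hU.monotone h), fun h => Nat.sInf_le h⟩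

/-! ### Expansions of `1` in a real base -/

/-- If the digits `a_i` are a monotone function of remainders `r_i` that satisfy
`r_{i+1} = β r_i - a_i` and `r_0` is the largest remainder, then no shift of `a` exceeds `a`. -/
theorem shift_le_of_monotone_digits {β : ℝ} (hβ : 0 < β) {r : ℕ → ℝ} {a : ℕ → ℕ} {φ : ℝ → ℕ}
    (hφ : Monotone φ) (ha : ∀ i, a i = φ (r i)) (hr : ∀ i, r (i + 1) = β * r i - a i)
    (hle : ∀ i, r i ≤ r 0) (i q : ℕ) (hq : ∀ j < q, a (i + j) = a j) : a (i + q) ≤ a q := by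
  have key : ∀ j ≤ q, r (i + j) ≤ r j := by
    intro j
    induction j with
    | zero => exact fun _ => hle i
    | succ j ih =>
      intro hj
      rw [← add_assoc, hr, hr, hq j hj]
      have := mul_le_mul_of_nonneg_left (ih (by omega)) hβ.le
      linarith
  rw [ha, ha q]
  exact hφ (key q le_rfl)

theorem betaOrbit_nonneg (β : ℝ) (i : ℕ) : 0 ≤ betaOrbit β i := by
  cases i with
  | zero => simp [betaOrbit]
  | succ i => exact Int.fract_nonneg _

theorem betaOrbit_succ_lt_one (β : ℝ) (i : ℕ) : betaOrbit β (i + 1) < 1 := Int.fract_lt_one _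

theorem betaOrbit_le_one (β : ℝ) (i : ℕ) : betaOrbit β i ≤ 1 := by
  cases i with
  | zero => simp [betaOrbit]
  | succ i => exact (betaOrbit_succ_lt_one β i).le

theorem betaOrbit_succ {β : ℝ} (hβ : 0 ≤ β) (i : ℕ) :
    betaOrbit β (i + 1) = β * betaOrbit β i - betaExpansion β i := by
  rw [betaOrbit, Int.fract, betaExpansion,
    natCast_floor_eq_intCast_floor (mul_nonneg hβ (betaOrbit_nonneg β i))]

theorem betaExpansion_shift_le {β : ℝ} (hβ : 1 < β) (i q : ℕ)
    (hq : ∀ j < q, betaExpansion β (i + j) = betaExpansion β j) :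
    betaExpansion β (i + q) ≤ betaExpansion β q := by
  have h0 : 0 < β := by linarith
  refine shift_le_of_monotone_digits h0 (φ := fun x => ⌊β * x⌋₊)
    (fun x y h => Nat.floor_mono (mul_le_mul_of_nonneg_left h h0.le)) (fun _ => rfl)
    (betaOrbit_succ h0.le) (betaOrbit_le_one β) i q hq

theorem betaExpansion_zero_pos {β : ℝ} (hβ : 1 < β) : 0 < betaExpansion β 0 := by
  simp [betaExpansion, betaOrbit, Nat.floor_pos, hβ.le]

/-- A remainder followed by zero digits only is zero, since it is multiplied by `β > 1` at each
step and stays below `1`. -/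
theorem betaOrbit_eq_zero {β : ℝ} (hβ : 1 < β) {ℓ : ℕ}
    (h : ∀ j, ℓ ≤ j → betaExpansion β j = 0) : betaOrbit β ℓ = 0 := by
  have key : ∀ j, betaOrbit β (ℓ + j) = β ^ j * betaOrbit β ℓ := by
    intro j
    induction j with
    | zero => simp
    | succ j ih =>
      rw [← add_assoc, betaOrbit_succ (by linarith), h _ (by omega), ih, pow_succ]
      push_cast
      ring
  by_contra hne
  have hpos := (betaOrbit_nonneg β ℓ).lt_of_ne' hne
  obtain ⟨j, hj⟩ := pow_unbounded_of_one_lt (1 / betaOrbit β ℓ) hβ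
  rw [div_lt_iff₀ hpos, ← key] at hj
  exact absurd (betaOrbit_le_one β _) (not_le.2 hj)

theorem betaOrbit_eq_zero_of_le {β : ℝ} {i j : ℕ} (h : betaOrbit β i = 0) (hij : i ≤ j) :
    betaOrbit β j = 0 := by
  induction j, hij using Nat.le_induction with
  | base => exact h
  | succ j _ ih => simp [betaOrbit, ih]

/-- The quasi-greedy expansion takes the digits `⌈β r_i⌉ - 1`, for remainders in `(0, 1]`. -/
theorem exists_quasiGreedy_orbit {β : ℝ} (hβ : 1 < β)
    (h : ∃ ℓ, ∀ j, ℓ ≤ j → betaExpansion β j = 0) :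
    ∃ r : ℕ → ℝ, r 0 = 1 ∧ (∀ i, r i ≤ 1) ∧
      (∀ i, r (i + 1) = β * r i - quasiGreedyExpansion β i) ∧
      ∀ i, quasiGreedyExpansion β i = ⌈β * r i⌉₊ - 1 := by
  classical
  have h0 : 0 < β := by linarith
  have hs := Nat.find_spec h
  have hmin := fun m => Nat.find_min h (m := m)
  have hq : ∀ i, quasiGreedyExpansion β i =
      if i % Nat.find h = Nat.find h - 1 then betaExpansion β (i % Nat.find h) - 1
      else betaExpansion β (i % Nat.find h) := fun i => by
    rw [quasiGreedyExpansion, dif_pos h]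
  generalize Nat.find h = ℓ at hs hmin hq
  have hℓ : 0 < ℓ := by
    rcases Nat.eq_zero_or_pos ℓ with rfl | h1
    · exact absurd (hs 0 le_rfl) (betaExpansion_zero_pos hβ).ne'
    · exact h1
  have hlast : betaExpansion β (ℓ - 1) ≠ 0 := fun h1 => by
    refine hmin (ℓ - 1) (by omega) fun j hj => ?_
    rcases hj.eq_or_lt with rfl | hj
    exacts [h1, hs j (by omega)]
  have hz := betaOrbit_eq_zero hβ hs
  have hpos : ∀ i < ℓ, 0 < betaOrbit β i := fun i hi => by
    refine (betaOrbit_nonneg β i).lt_of_ne' fun h1 => hlast ?_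
    rw [betaExpansion, betaOrbit_eq_zero_of_le h1 (by omega)]
    simp
  have hexp : β * betaOrbit β (ℓ - 1) = betaExpansion β (ℓ - 1) := by
    have := betaOrbit_succ h0.le (ℓ - 1)
    rw [Nat.sub_add_cancel hℓ, hz] at this
    linarith
  refine ⟨fun i => betaOrbit β (i % ℓ), by simp [betaOrbit], fun i => betaOrbit_le_one β _,
    fun i => ?_, fun i => ?_⟩
  · have hi := Nat.mod_lt i hℓ
    simp only [hq]
    split_ifs with hc
    · have : (i + 1) % ℓ = 0 := by rw [add_one_mod_eq_ite hℓ, if_pos hc]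
      rw [this, hc, Nat.cast_sub (Nat.one_le_iff_ne_zero.2 hlast), hexp]
      simp [betaOrbit]
    · have : (i + 1) % ℓ = i % ℓ + 1 := by rw [add_one_mod_eq_ite hℓ, if_neg hc]
      rw [this, betaOrbit_succ h0.le]
  · have hi := Nat.mod_lt i hℓ
    simp only [hq]
    split_ifs with hc
    · rw [hc, hexp, Nat.ceil_natCast]
    · have h1 := betaOrbit_succ h0.le (i % ℓ)
      have h2 := hpos (i % ℓ + 1) (by omega)
      have h3 := betaOrbit_succ_lt_one β (i % ℓ)
      have : ⌈β * betaOrbit β (i % ℓ)⌉₊ = betaExpansion β (i % ℓ) + 1 := by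
        rw [Nat.ceil_eq_iff (by omega)]
        push_cast
        constructor <;> linarith
      rw [this, Nat.add_sub_cancel]

theorem quasiGreedyExpansion_shift_le {β : ℝ} (hβ : 1 < β) (i q : ℕ)
    (hq : ∀ j < q, quasiGreedyExpansion β (i + j) = quasiGreedyExpansion β j) :
    quasiGreedyExpansion β (i + q) ≤ quasiGreedyExpansion β q := by
  by_cases h : ∃ ℓ, ∀ j, ℓ ≤ j → betaExpansion β j = 0
  · have h0 : 0 < β := by linarith
    obtain ⟨r, r0, r1, r2, r3⟩ := exists_quasiGreedy_orbit hβ h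
    exact shift_le_of_monotone_digits h0 (φ := fun x => ⌈β * x⌉₊ - 1)
      (fun x y h => Nat.sub_le_sub_right (Nat.ceil_mono (mul_le_mul_of_nonneg_left h h0.le)) 1)
      r3 r2 (fun i => by rw [r0]; exact r1 i) i q hq
  · simp only [quasiGreedyExpansion, dif_neg h] at hq ⊢
    exact betaExpansion_shift_le hβ i q hq

theorem quasiGreedyExpansion_zero_pos {β : ℝ} (hβ : 1 < β) : 0 < quasiGreedyExpansion β 0 := by
  by_cases h : ∃ ℓ, ∀ j, ℓ ≤ j → betaExpansion β j = 0
  · obtain ⟨r, r0, -, -, r3⟩ := exists_quasiGreedy_orbit hβ h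
    rw [r3, r0, mul_one]
    have : 1 < ⌈β⌉₊ := Nat.lt_ceil.2 (by simpa using hβ)
    omega
  · simp only [quasiGreedyExpansion, dif_neg h]
    exact betaExpansion_zero_pos hβ

/-! ### Words that dominate their shifts are expansions of `1` -/

/-- A bounded word `t ≠ 1 0^ω` with `t_0 > 0` is an expansion of `1` in some base `x⁻¹ > 1`. -/
theorem exists_base {t : ℕ → ℕ} {B : ℕ} (hB : ∀ i, t i ≤ B) (h0 : 0 < t 0)
    (hne : t ≠ Pi.single 0 1) : ∃ x : ℝ, 0 < x ∧ x < 1 ∧ ∑' j, (t j : ℝ) * x ^ (j + 1) = 1 := by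
  have hbd : ∀ {b x : ℝ}, 0 ≤ x → x ≤ b → ∀ j, ‖(t j : ℝ) * x ^ (j + 1)‖ ≤ B * b * b ^ j := by
    intro b x hx hb j
    rw [Real.norm_of_nonneg (by positivity), mul_assoc, ← pow_succ']
    exact mul_le_mul (by exact_mod_cast hB j) (pow_le_pow_left₀ hx hb _) (by positivity)
      (by positivity)
  -- Some digit other than one unit of `t_0` is positive, so `f(b) ≥ b + b^(N+1)` for some `N`.
  obtain ⟨N, hN⟩ : ∃ N, ∀ b : ℝ, 0 ≤ b → b < 1 →
      b + b ^ (N + 1) ≤ ∑' j, (t j : ℝ) * b ^ (j + 1) := by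
    have hsum : ∀ b : ℝ, 0 ≤ b → b < 1 → Summable fun j => (t j : ℝ) * b ^ (j + 1) :=
      fun b hb hb1 => Summable.of_norm_bounded
        ((summable_geometric_of_lt_one hb hb1).mul_left (B * b)) (hbd hb le_rfl)
    by_cases h2 : 2 ≤ t 0
    · refine ⟨0, fun b hb hb1 => le_trans ?_ ((hsum b hb hb1).le_tsum 0 fun j _ => by positivity)⟩
      have : (2 : ℝ) ≤ t 0 := by exact_mod_cast h2
      simp only [zero_add, pow_one]
      nlinarith
    · obtain ⟨N, hN⟩ := Function.ne_iff.1 hne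
      have hN0 : N ≠ 0 := by
        rintro rfl
        simp at hN
        omega
      simp only [Pi.single_apply, if_neg hN0] at hN
      refine ⟨N, fun b hb hb1 => le_trans ?_
        ((hsum b hb hb1).sum_le_tsum {0, N} fun j _ => by positivity)⟩
      rw [Finset.sum_pair hN0.symm]
      have h1 : (1 : ℝ) ≤ t 0 := by exact_mod_cast h0
      have h3 : (1 : ℝ) ≤ t N := by exact_mod_cast Nat.one_le_iff_ne_zero.2 hN
      have h4 : 0 ≤ b ^ (N + 1) := by positivity
      simp only [zero_add, pow_one]
      nlinarith
  -- Bernoulli's inequality gives `b^(N+1) ≥ 1/2` for this `b`.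
  set b : ℝ := 1 - 1 / (2 * (N + 1)) with hb
  have hN1 : (0 : ℝ) < N + 1 := by positivity
  have hbhalf : 1 / 2 ≤ b := by
    have : 1 / (2 * ((N : ℝ) + 1)) ≤ 1 / 2 := by
      apply one_div_le_one_div_of_le <;> [norm_num; skip]
      have : (0 : ℝ) ≤ N := by positivity
      linarith
    rw [hb]; linarith
  have hb1 : b < 1 := by
    have : 0 < 1 / (2 * ((N : ℝ) + 1)) := by positivity
    rw [hb]; linarith
  have hpow : 1 / 2 ≤ b ^ (N + 1) := by
    have := one_add_mul_le_pow (a := b - 1) (by linarith) (N + 1)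
    rw [add_sub_cancel] at this
    refine le_trans (le_of_eq ?_) this
    rw [hb]
    push_cast
    field_simp
    ring
  have hcont : ContinuousOn (fun x : ℝ => ∑' j, (t j : ℝ) * x ^ (j + 1)) (Set.Icc 0 b) :=
    continuousOn_tsum (fun j => by fun_prop)
      ((summable_geometric_of_lt_one (by linarith) hb1).mul_left (B * b))
      fun j x hx => hbd hx.1 hx.2 j
  obtain ⟨x, hx, hx1⟩ := intermediate_value_Icc (by linarith) hcont
    (show (1 : ℝ) ∈ Set.Icc _ _ from ⟨by simp, by
      have := hN b (by linarith) hb1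
      linarith⟩)
  refine ⟨x, hx.1.lt_of_ne' ?_, hx.2.trans_lt hb1, hx1⟩
  rintro rfl
  simp at hx1

/-- The remainders `r_i = ∑_j t_{i+j} β^{-(j+1)}` of such an expansion. -/
theorem exists_remainders {t : ℕ → ℕ} {B : ℕ} (hB : ∀ i, t i ≤ B) (h0 : 0 < t 0)
    (hne : t ≠ Pi.single 0 1) : ∃ (β : ℝ) (r : ℕ → ℝ) (C : ℝ), 1 < β ∧ r 0 = 1 ∧
      (∀ i, 0 ≤ r i) ∧ (∀ i, r i ≤ C) ∧ (∀ i, r (i + 1) = β * r i - t i) ∧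
      ∀ i, (∀ j, i ≤ j → t j = 0) → r i = 0 := by
  obtain ⟨x, hx0, hx1, hx⟩ := exists_base hB h0 hne
  have hgeo := (summable_geometric_of_lt_one hx0.le hx1).mul_left (B * x)
  have hbd : ∀ i j, ‖(t (i + j) : ℝ) * x ^ (j + 1)‖ ≤ B * x * x ^ j := by
    intro i j
    rw [Real.norm_of_nonneg (by positivity), mul_assoc, ← pow_succ']
    exact mul_le_mul_of_nonneg_right (by exact_mod_cast hB _) (by positivity)
  refine ⟨x⁻¹, fun i => ∑' j, (t (i + j) : ℝ) * x ^ (j + 1), ∑' j, B * x * x ^ j,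
    (one_lt_inv₀ hx0).2 hx1, by simpa using hx, fun i => tsum_nonneg fun j => by positivity,
    fun i => ?_, fun i => ?_, fun i hi => ?_⟩
  · exact (Summable.of_norm_bounded hgeo (hbd i)).tsum_le_tsum
      (fun j => (le_abs_self _).trans (hbd i j)) hgeo
  · simp only
    rw [(Summable.of_norm_bounded hgeo (hbd i)).tsum_eq_zero_add]
    have : ∀ j, (t (i + (j + 1)) : ℝ) * x ^ (j + 1 + 1) =
        x * ((t (i + 1 + j) : ℝ) * x ^ (j + 1)) := fun j => by
      rw [show i + (j + 1) = i + 1 + j by omega]; ring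
    simp only [this, tsum_mul_left]
    simp only [add_zero, zero_add, pow_one]
    field_simp
    ring
  · simp [hi _ (Nat.le_add_right i _)]

/-- If `t` dominates its shifts, then the remainders are at most `1`: an excess over `1` is at
most the largest excess divided by `β`. -/
theorem remainder_le_one {t : ℕ → ℕ} (h : ∀ i q, (∀ j < q, t (i + j) = t j) → t (i + q) ≤ t q)
    {β C : ℝ} {r : ℕ → ℝ} (hβ : 1 < β) (r0 : r 0 = 1) (rnn : ∀ i, 0 ≤ r i) (hC : ∀ i, r i ≤ C)
    (hr : ∀ i, r (i + 1) = β * r i - t i) (i : ℕ) : r i ≤ 1 := by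
  have hC1 : 1 ≤ C := r0 ▸ hC 0
  have hdiff : ∀ i q, (∀ j < q, t (i + j) = t j) → r (i + q) - r q = β ^ q * (r i - 1) := by
    intro i q
    induction q with
    | zero => simp [r0]
    | succ q ih =>
      intro hq
      rw [← add_assoc, hr, hr, hq q (by omega), pow_succ', mul_assoc,
        ← ih fun j hj => hq j (by omega)]
      ring
  have step : ∀ m i, β ^ m * (r i - 1) ≤ C - 1 := by
    intro m
    induction m with
    | zero => intro i; simpa using hC i
    | succ m ih =>
      intro i
      by_contra! hlt
      have hpos : 0 < r i - 1 := by
        by_contra! hneg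
        have : β ^ (m + 1) * (r i - 1) ≤ 0 :=
          mul_nonpos_of_nonneg_of_nonpos (by positivity) hneg
        linarith
      by_cases hex : ∃ q, t (i + q) ≠ t q
      · classical
        have hq := Nat.find_spec hex
        have hmin : ∀ j < Nat.find hex, t (i + j) = t j := fun j hj => by
          simpa using Nat.find_min hex hj
        generalize Nat.find hex = q at hq hmin
        have hlt' : t (i + q) < t q := lt_of_le_of_ne (h i q hmin) hq
        have hd := hdiff i q hmin
        have h1 : (t (i + q) : ℝ) + 1 ≤ t q := by exact_mod_cast hlt'
        -- Just after the first difference the excess has been multiplied by `β^(q+1) ≥ β`.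
        have h2 : β ^ (q + 1) * (r i - 1) ≤ r (i + q + 1) - 1 := by
          rw [pow_succ', mul_assoc, ← hd, hr]
          have := rnn (q + 1)
          rw [hr] at this
          linarith
        have h3 : β * (r i - 1) ≤ β ^ (q + 1) * (r i - 1) :=
          mul_le_mul_of_nonneg_right (le_self_pow₀ hβ.le (by omega)) hpos.le
        have h4 : β ^ m * (β * (r i - 1)) ≤ β ^ m * (r (i + q + 1) - 1) :=
          mul_le_mul_of_nonneg_left (h3.trans h2) (by positivity)
        have h5 := ih (i + q + 1)
        rw [pow_succ, mul_assoc] at hlt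
        linarith
      · push Not at hex
        obtain ⟨q, hq⟩ := pow_unbounded_of_one_lt (C / (r i - 1)) hβ
        rw [div_lt_iff₀ hpos, ← hdiff i q fun j _ => hex j] at hq
        have := hC (i + q)
        have := rnn q
        linarith
  by_contra! hlt
  have hpos : 0 < r i - 1 := by linarith
  obtain ⟨q, hq⟩ := pow_unbounded_of_one_lt ((C - 1) / (r i - 1)) hβ
  rw [div_lt_iff₀ hpos] at hq
  exact absurd (step q i) (not_le.2 hq)

theorem betaOrbit_eq_remainder {β : ℝ} {r : ℕ → ℝ} {t : ℕ → ℕ} (hβ : 1 < β) (r0 : r 0 = 1)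
    (rnn : ∀ i, 0 ≤ r i) (hr : ∀ i, r (i + 1) = β * r i - t i) (p : ℕ)
    (hp : ∀ i < p, r (i + 1) < 1) :
    (∀ i ≤ p, betaOrbit β i = r i) ∧ ∀ i < p, betaExpansion β i = t i := by
  have hexp : ∀ i < p, betaOrbit β i = r i → betaExpansion β i = t i := by
    intro i hi hb
    have h1 := hp i hi
    have h2 := rnn (i + 1)
    rw [hr] at h1 h2
    rw [betaExpansion, hb, Nat.floor_eq_iff (by have : (0 : ℝ) ≤ t i := by positivity
                                                linarith)]
    constructor <;> linarith
  have horb : ∀ i ≤ p, betaOrbit β i = r i := by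
    intro i
    induction i with
    | zero => intro _; rw [r0]; rfl
    | succ i ih =>
      intro hi
      have := ih (by omega)
      rw [betaOrbit_succ (by linarith), hexp i hi this, this, hr]
  exact ⟨horb, fun i hi => hexp i hi (horb i hi.le)⟩

/-- A word other than `1 0^ω` that dominates its shifts is the greedy or the quasi-greedy expansion
of `1` in some base: the greedy one if no remainder after the first is `1`, the quasi-greedy one
otherwise. -/
theorem exists_eq_expansion {t : ℕ → ℕ} (h0 : 0 < t 0) (hne : t ≠ Pi.single 0 1)
    (h : ∀ i q, (∀ j < q, t (i + j) = t j) → t (i + q) ≤ t q) :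
    ∃ β : ℝ, 1 < β ∧ (t = quasiGreedyExpansion β ∨ t = betaExpansion β) := by
  have hB : ∀ i, t i ≤ t 0 := fun i => h i 0 (by simp)
  obtain ⟨β, r, C, hβ, r0, rnn, hC, hr, hrz⟩ := exists_remainders hB h0 hne
  have hle := remainder_le_one h hβ r0 rnn hC hr
  refine ⟨β, hβ, ?_⟩
  by_cases hex : ∃ p, r (p + 1) = 1
  swap
  · right
    push Not at hex
    funext i
    exact ((betaOrbit_eq_remainder hβ r0 rnn hr (i + 1) fun j _ =>
      (hle _).lt_of_ne (hex j)).2 i (by omega)).symm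
  left
  classical
  have hp := Nat.find_spec hex
  have hmin : ∀ j < Nat.find hex, r (j + 1) < 1 := fun j hj =>
    (hle _).lt_of_ne (Nat.find_min hex hj)
  generalize Nat.find hex = p at hp hmin
  obtain ⟨horb, hdig⟩ := betaOrbit_eq_remainder hβ r0 rnn hr p hmin
  have hrp := hr p
  rw [hp] at hrp
  have hlast : betaExpansion β p = t p + 1 := by
    rw [betaExpansion, horb p le_rfl, show β * r p = ((t p + 1 : ℕ) : ℝ) by push_cast; linarith,
      Nat.floor_natCast]
  have hz : betaOrbit β (p + 1) = 0 := by
    rw [betaOrbit_succ (by linarith), hlast, horb p le_rfl]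
    push_cast
    linarith
  have hfin : ∀ j, p + 1 ≤ j → betaExpansion β j = 0 := fun j hj => by
    rw [betaExpansion, betaOrbit_eq_zero_of_le hz hj]
    simp
  have hfin' : ∃ ℓ, ∀ j, ℓ ≤ j → betaExpansion β j = 0 := ⟨_, hfin⟩
  have hfind : Nat.find hfin' = p + 1 := by
    rw [Nat.find_eq_iff]
    refine ⟨hfin, fun m hm hcon => ?_⟩
    have := hcon p (by omega)
    omega
  -- The word and its shift by `p + 1` have the same value. If `q` were the first position where
  -- they differ, then `r_{q+1} = 0` and `r_{p+1+q+1} = 1`; but all remainders after a zero one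
  -- vanish.
  have hper : ∀ i, t (p + 1 + i) = t i := by
    intro i
    induction i using Nat.strong_induction_on with
    | _ q ih =>
      have heq : ∀ j ≤ q, r (p + 1 + j) = r j := by
        intro j
        induction j with
        | zero => intro _; rw [r0]; exact hp
        | succ j ihj =>
          intro hj
          rw [← add_assoc, hr, hr, ihj (by omega), ih j (by omega)]
      by_contra hq
      have hlt : t (p + 1 + q) < t q := lt_of_le_of_ne (h _ q ih) hq
      have h1 : (t (p + 1 + q) : ℝ) + 1 ≤ t q := by exact_mod_cast hlt
      have h2 := hr (p + 1 + q)
      rw [heq q le_rfl] at h2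
      have h3 := hr q
      have h4 := rnn (q + 1)
      have h5 := hle (p + 1 + q + 1)
      have hr0 : r (q + 1) = 0 := by linarith
      have hr1 : r (p + 1 + q + 1) = 1 := by linarith
      have hzero : ∀ j, r (q + 1 + j) = 0 := by
        intro j
        induction j with
        | zero => exact hr0
        | succ j ihj =>
          have h6 := hr (q + 1 + j)
          have h7 := rnn (q + 1 + j + 1)
          have h8 : (0 : ℝ) ≤ t (q + 1 + j) := by positivity
          rw [ihj] at h6
          rw [← add_assoc]
          linarith
      have := hzero (p + 1)
      rw [show q + 1 + (p + 1) = p + 1 + q + 1 by omega, hr1] at this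
      exact one_ne_zero this
  have hmod : ∀ i, t i = t (i % (p + 1)) := fun i => by
    have : Function.Periodic t (p + 1) := fun i => by rw [add_comm, hper]
    exact (this.map_mod_nat i).symm
  funext i
  have hi := Nat.mod_lt i (show 0 < p + 1 by omega)
  rw [quasiGreedyExpansion, dif_pos hfin', hmod i]
  have hf : @Nat.find (fun ℓ => ∀ j, ℓ ≤ j → betaExpansion β j = 0)
    (fun a => Classical.propDecidable _) hfin' = p + 1 := by convert hfind
  rw [hf, Nat.add_sub_cancel]
  split_ifs with hc
  · rw [hc, hlast, Nat.add_sub_cancel]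
  · exact (hdig _ (by omega)).symm

/-! ### Comparison of the two representations -/

/-- Every sequence of Bertrand weights is the sequence of weights of a word that starts with a
positive digit and dominates its shifts. For the trivial weights this is the word `1 0^ω`. -/
theorem IsBertrandWeights.exists_eq_weightsOf {U : ℕ → ℕ} (hU : IsBertrandWeights U) :
    ∃ e : ℕ → ℕ, U = weightsOf e ∧ 0 < e 0 ∧
      ∀ i q, (∀ j < q, e (i + j) = e j) → e (i + q) ≤ e q := by
  rcases hU with hU | ⟨β, hβ, rfl⟩ | ⟨β, hβ, rfl⟩
  · refine ⟨Pi.single 0 1, ?_, by simp, fun i q hq => ?_⟩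
    · rw [weightsOf_single]
      exact funext hU
    · rcases Nat.eq_zero_or_pos q with rfl | h
      · simp only [Pi.single_apply]
        split_ifs <;> omega
      · have := hq 0 h
        simp only [Pi.single_apply] at this ⊢
        split_ifs at this ⊢ <;> omega
  · exact ⟨_, rfl, quasiGreedyExpansion_zero_pos hβ, quasiGreedyExpansion_shift_le hβ⟩
  · exact ⟨_, rfl, betaExpansion_zero_pos hβ, betaExpansion_shift_le hβ⟩

theorem isBertrandWeights_weightsOf {t : ℕ → ℕ} (h0 : 0 < t 0)
    (h : ∀ i q, (∀ j < q, t (i + j) = t j) → t (i + q) ≤ t q) :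
    IsBertrandWeights (weightsOf t) := by
  by_cases hne : t = Pi.single 0 1
  · left
    rw [hne, weightsOf_single]
    exact fun _ => rfl
  · right
    obtain ⟨β, hβ, rfl | rfl⟩ := exists_eq_expansion h0 hne h
    exacts [Or.inl ⟨β, hβ, rfl⟩, Or.inr ⟨β, hβ, rfl⟩]

theorem mainTheorem6 {n : ℕ} [NeZero n] (k : Fin n) (d : Fin n → ℕ) (hd : 0 < d 0) :
    (∃ rep : ℕ → List ℕ, IsBertrandRep rep ∧
      ∀ m : ℕ, (fabreLike k d hd).dumontThomasRep (fabreFixedPoint k d hd)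
        (fabreFixedPoint_isFixedPoint k d hd) (fabreImage_isGrowing k d hd) m = rep m) ↔
    ∀ i : ℕ, toLex (fun j => parryWord k d (i + j)) ≤ toLex (parryWord k d) := by
  simp only [toLex_le_toLex_iff_first_diff]
  have h0 : 0 < parryWord k d 0 := by rwa [parryWord_eq, fabreState_zero]
  constructor
  · rintro ⟨_, ⟨U, hU, rfl⟩, hrep⟩
    obtain ⟨e, rfl, he0, he⟩ := hU.exists_eq_weightsOf
    -- The representations of length at most `ℓ` are those of the numbers below the `ℓ`-th weight.
    have hlt : ∀ ℓ m, m < weightsOf (parryWord k d) ℓ ↔ m < weightsOf e ℓ := by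
      intro ℓ m
      obtain ⟨p, -, -, hp, hl⟩ := exists_dumontThomasRep_eq k d hd m
      have h1 := congrArg List.length (hp.symm.trans (hrep m))
      rw [List.length_map, greedyRep, length_greedyDigits] at h1
      rw [← hl, h1, sInf_lt_weight_le_iff (weightsOf_strictMono e he0)]
    have hw : parryWord k d = e := weightsOf_injective <| funext fun ℓ =>
      le_antisymm (not_lt.1 fun h => lt_irrefl _ ((hlt _ _).1 h))
        (not_lt.1 fun h => lt_irrefl _ ((hlt _ _).2 h))
    rw [hw]
    exact he
  · intro h
    refine ⟨greedyRep (weightsOf (parryWord k d)),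
      ⟨_, isBertrandWeights_weightsOf h0 h, rfl⟩, fun m => ?_⟩
    obtain ⟨p, hp, hm, hrep, hl⟩ := exists_dumontThomasRep_eq k d hd m
    have hlen : p.length = sInf {ℓ | m < weightsOf (parryWord k d) ℓ} :=
      eq_of_forall_ge_iff fun ℓ => by
        rw [hl, sInf_lt_weight_le_iff (weightsOf_strictMono _ h0)]
    have hle : ∀ ℓ i, tailWeight (parryWord k d) ℓ i ≤ weightsOf (parryWord k d) ℓ :=
      fun ℓ i => by
        rw [← tailWeight_zero_right]
        exact tailWeight_add_le _ h ℓ i 0 (by simp)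
    rw [hrep, greedyRep, ← hlen,
      map_length_eq_greedyDigits k d hd hle p 0 (by rwa [fabreState_zero]), hm]
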